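/- Let $K$ be a field of characteristic different from $2$. A (not necessarily associative) superalgebra $A=A_0\oplus A_1$ over $K$, with $A_iA_j\subseteq A_{i+j \bmod 2}$, is called bicommutative if $$x_1(x_2x_3)=(-1)^{\overline{x_1}\,\overline{x_2}}x_2(x_1x_3),\qquad (x_1x_2)x_3=(-1)^{\overline{x_2}\,\overline{x_3}}(x_1x_3)x_2$$ for all homogeneous $x_1,x_2,x_3\in A$, where $\overline{x}\in\{0,1\}$ denotes the parity of $x$. Let $p,q\ge 0$ and let $F_{p,q}=F_{p,q}(\mathfrak B_{\sup})$ be the free (non-unital) bicommutative superalgebra over $K$ freely generated by $p$ even variables $y_1,\dots,y_p$ and $q$ odd variables $z_1,\dots,z_q$. For $\mathbf k=(k_1,\dots,k_p)\in\mathbb N_0^p$ and $\mathbf l=(l_1,\dots,l_q)\in\mathbb N_0^q$ let $F_{p,q}^{(\mathbf k,\mathbf l)}$ be the multihomogeneous component of the elements of degree $k_i$ in $y_i$ and of degree $l_j$ in $z_j$ for all $i,j$, and for $k,l\in\mathbb N_0$ let $F_{p,q}^{(k,l)}$ be the component of the elements that are homogeneous of total degree $k$ in the even variables and of total degree $l$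 in the odd variables. All the components below are finite-dimensional, and, with $\delta_{i,j}$ the Kronecker delta, $$\dim F_{p,q}^{(\mathbf k,\mathbf l)}=\prod_{i=1}^p(k_i+1)\prod_{j=1}^q(\delta_{2,l_j}+2\delta_{1,l_j}+\delta_{0,l_j})-2\prod_{j=1}^q(\delta_{1,l_j}+\delta_{0,l_j})\quad\text{if }\sum_{i=1}^pk_i+\sum_{j=1}^ql_j>1,$$ $$\dim F_{p,q}^{(\mathbf k,\mathbf l)}=1\quad\text{if }\sum_{i=1}^pk_i+\sum_{j=1}^ql_j=1,$$ and $$\dim F_{p,q}^{(k,l)}=\begin{cases}\displaystyle\binom{k+2p-1}{k}\binom{2q}{l}-2\binom{k+p-1}{k}\binom{q}{l},&\text{if }k+l>1,\\ p,&\text{if }(k,l)=(1,0),\\ q,&\text{if }(k,l)=(0,1),\end{cases}$$ where $\binom{-1}{0}=1$. -/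

import Mathlib

noncomputable section

namespace BicommSuper

/-- The generators `y₁, …, y_p` (`Sum.inl i`, even) and `z₁, …, z_q` (`Sum.inr j`, odd). -/
abbrev Gen (p q : ℕ) : Type := Fin p ⊕ Fin q

/-- The number of occurrences of the generator `x` in a nonassociative monomial. -/
def degree {p q : ℕ} (x : Gen p q) : FreeMagma (Gen p q) → ℕ
  | .of y => if y = x then 1 else 0
  | .mul m n => degree x m + degree x n

/-- The degree of a nonassociative monomial with respect to all even generators. -/
def evenDegree {p q : ℕ} (m : FreeMagma (Gen p q)) : ℕ := ∑ i : Fin p, degree (Sum.inl i) m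

/-- The degree of a nonassociative monomial with respect to all odd generators. -/
def oddDegree {p q : ℕ} (m : FreeMagma (Gen p q)) : ℕ := ∑ j : Fin q, degree (Sum.inr j) m

/-- The sign `(-1) ^ (i * j)` for parities `i`, `j`. -/
def sign (K : Type*) [Field K] (i j : ZMod 2) : K := (-1) ^ (i.val * j.val)

/-- The free nonassociative algebra (without unit) on the generators. -/
abbrev FreeNonassoc (K : Type*) [Field K] (p q : ℕ) : Type _ :=
  FreeNonUnitalNonAssocAlgebra K (Gen p q)

/-- The even (`i = 0`) and the odd (`i = 1`) component of the free nonassociative algebra: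
the span of the monomials of parity `i`, that is, whose number of odd factors is `i` modulo 2. -/
def parityPart (K : Type*) [Field K] (p q : ℕ) (i : ZMod 2) : Submodule K (FreeNonassoc K p q) :=
  Submodule.span K {f | ∃ m : FreeMagma (Gen p q),
    ((oddDegree m : ℕ) : ZMod 2) = i ∧ f = MonoidAlgebra.ofMagma K _ m}

/-- The values of the super-left-commutative and the super-right-commutative super-identity
at parity-homogeneous elements of the free nonassociative superalgebra. -/
def identityValues (K : Type*) [Field K] (p q : ℕ) : Set (FreeNonassoc K p q) :=
  {f | ∃ i j k : ZMod 2, ∃ a ∈ parityPart K p q i, ∃ b ∈ parityPart K p q j,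
    ∃ c ∈ parityPart K p q k,
      f = a * (b * c) - sign K i j • (b * (a * c)) ∨
      f = (a * b) * c - sign K j k • ((a * c) * b)}

/-- The (two-sided, `K`-linear) ideal generated by the values of the two super-identities. -/
def identityIdeal (K : Type*) [Field K] (p q : ℕ) : Submodule K (FreeNonassoc K p q) :=
  sInf {I | identityValues K p q ⊆ I ∧
    ∀ a : FreeNonassoc K p q, ∀ f ∈ I, a * f ∈ I ∧ f * a ∈ I}

theorem mul_mem_identityIdeal {K : Type*} [Field K] {p q : ℕ} (a : FreeNonassoc K p q)
    {f : FreeNonassoc K p q} (hf : f ∈ identityIdeal K p q) :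
    a * f ∈ identityIdeal K p q ∧ f * a ∈ identityIdeal K p q := by
  simp only [identityIdeal, Submodule.mem_sInf] at hf ⊢
  exact ⟨fun I hI => (hI.2 a f (hf I hI)).1, fun I hI => (hI.2 a f (hf I hI)).2⟩

/-- The free bicommutative superalgebra `F_{p,q}` on `p` even and `q` odd generators: the
quotient of the free nonassociative superalgebra by the ideal of the two super-identities. -/
def FreeBicomm (K : Type*) [Field K] (p q : ℕ) : Type _ :=
  FreeNonassoc K p q ⧸ identityIdeal K p q

instance (K : Type*) [Field K] (p q : ℕ) : AddCommGroup (FreeBicomm K p q) :=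
  inferInstanceAs (AddCommGroup (FreeNonassoc K p q ⧸ identityIdeal K p q))

instance (K : Type*) [Field K] (p q : ℕ) : Module K (FreeBicomm K p q) :=
  inferInstanceAs (Module K (FreeNonassoc K p q ⧸ identityIdeal K p q))

/-- The quotient map. -/
def toFree (K : Type*) [Field K] (p q : ℕ) : FreeNonassoc K p q →ₗ[K] FreeBicomm K p q :=
  (identityIdeal K p q).mkQ

/-- The multiplication induced on the quotient: `toFree a * toFree b = toFree (a * b)`. -/
instance (K : Type*) [Field K] (p q : ℕ) : Mul (FreeBicomm K p q) where
  mul := Quotient.map₂ (· * ·) (by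
    intro a a' ha b b' hb
    replace ha := (Submodule.quotientRel_def _).mp ha
    replace hb := (Submodule.quotientRel_def _).mp hb
    refine (Submodule.quotientRel_def _).mpr ?_
    have h : a * b - a' * b' = (a - a') * b + a' * (b - b') := by
      rw [sub_mul, mul_sub]; abel
    rw [h]
    exact add_mem (mul_mem_identityIdeal b ha).2 (mul_mem_identityIdeal a' hb).1)

theorem toFree_mul {K : Type*} [Field K] {p q : ℕ} (a b : FreeNonassoc K p q) :
    toFree K p q (a * b) = toFree K p q a * toFree K p q b := rfl

theorem toFree_surjective (K : Type*) [Field K] (p q : ℕ) :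
    Function.Surjective (toFree K p q) := Submodule.mkQ_surjective _

instance (K : Type*) [Field K] (p q : ℕ) : NonUnitalNonAssocRing (FreeBicomm K p q) where
  left_distrib a b c := by
    obtain ⟨a, rfl⟩ := toFree_surjective K p q a
    obtain ⟨b, rfl⟩ := toFree_surjective K p q b
    obtain ⟨c, rfl⟩ := toFree_surjective K p q c
    simp only [← map_add, ← toFree_mul, mul_add]
  right_distrib a b c := by
    obtain ⟨a, rfl⟩ := toFree_surjective K p q a
    obtain ⟨b, rfl⟩ := toFree_surjective K p q b
    obtain ⟨c, rfl⟩ := toFree_surjective K p q c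
    simp only [← map_add, ← toFree_mul, add_mul]
  zero_mul a := by
    obtain ⟨a, rfl⟩ := toFree_surjective K p q a
    rw [← map_zero (toFree K p q), ← toFree_mul, zero_mul]
  mul_zero a := by
    obtain ⟨a, rfl⟩ := toFree_surjective K p q a
    rw [← map_zero (toFree K p q), ← toFree_mul, mul_zero]

instance (K : Type*) [Field K] (p q : ℕ) :
    IsScalarTower K (FreeBicomm K p q) (FreeBicomm K p q) where
  smul_assoc r a b := by
    obtain ⟨a, rfl⟩ := toFree_surjective K p q a
    obtain ⟨b, rfl⟩ := toFree_surjective K p q b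
    simp only [smul_eq_mul, ← map_smul, ← toFree_mul, smul_mul_assoc]

instance (K : Type*) [Field K] (p q : ℕ) :
    SMulCommClass K (FreeBicomm K p q) (FreeBicomm K p q) where
  smul_comm r a b := by
    obtain ⟨a, rfl⟩ := toFree_surjective K p q a
    obtain ⟨b, rfl⟩ := toFree_surjective K p q b
    simp only [smul_eq_mul, ← map_smul, ← toFree_mul, mul_smul_comm]

/-- The free generators of `F_{p,q}`. -/
def gen (K : Type*) [Field K] (p q : ℕ) (x : Gen p q) : FreeBicomm K p q :=
  toFree K p q (FreeNonUnitalNonAssocAlgebra.of K x)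

/-- The value in `F_{p,q}` of a nonassociative monomial in the free generators. -/
def monomial (K : Type*) [Field K] (p q : ℕ) : FreeMagma (Gen p q) →ₙ* FreeBicomm K p q :=
  FreeMagma.lift (gen K p q)

/-- The component of `F_{p,q}` of multidegree `(k₁, …, k_p, l₁, …, l_q)`, where `kᵢ` is the
degree in the even generator `yᵢ` and `lⱼ` the degree in the odd generator `zⱼ`. -/
def multiComponent (K : Type*) [Field K] {p q : ℕ} (k : Fin p → ℕ) (l : Fin q → ℕ) :
    Submodule K (FreeBicomm K p q) :=
  Submodule.span K {f | ∃ m : FreeMagma (Gen p q),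
    (∀ i, degree (Sum.inl i) m = k i) ∧ (∀ j, degree (Sum.inr j) m = l j) ∧
      f = monomial K p q m}

/-- The component of `F_{p,q}` of the elements that are homogeneous of degree `k` in the even
generators and of degree `l` in the odd generators. -/
def biComponent (K : Type*) [Field K] (p q k l : ℕ) : Submodule K (FreeBicomm K p q) :=
  Submodule.span K {f | ∃ m : FreeMagma (Gen p q),
    evenDegree m = k ∧ oddDegree m = l ∧ f = monomial K p q m}

/-- The Kronecker delta. -/
def kdelta (a b : ℕ) : ℤ := if a = b then 1 else 0

/-- `V` is finite-dimensional and its dimension is the integer `d`. -/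
def HasDim (K : Type*) [Field K] {W : Type*} [AddCommGroup W] [Module K W]
    (V : Submodule K W) (d : ℤ) : Prop :=
  Module.Finite K V ∧ (Module.finrank K V : ℤ) = d

end BicommSuper

end

noncomputable section

namespace BicommSuper

/-! Give each generator x two symbols, u_x and v_x, of the parity of x, and compare the free
bicommutative superalgebra with the free supercommutative algebra on all these symbols. A generator
becomes u_x as a left factor and v_x as a right factor; in either role a product becomes (left image
of its first factor) times (right image of its second). Then a(bc) goes to u(a)u(b)v(c) and (ab)c to
u(a)v(b)v(c), so both identities become supercommutativity and the left image descends to the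
quotient (`toSuper`).

Upper bound: modulo signs, the monomials form a magma in which left multiplications commute and
right multiplications commute. There, left and right multiplications also commute on products, so a
product depends only on the multisets of its u-letters and v-letters (`map_eq_of_leftExp_eq`). An
odd letter repeated on one side allows a swap giving w = -w, hence w = 0 in characteristic different
from 2 (`monomial_eq_zero`).

Lower bound: monomials with distinct reduced exponents map to nonzero multiples of distinct basis
vectors. Thus a component has as dimension the number of its reduced exponents that occur
(`hasDim_span_monomial`). In total degree above 1 these are the pairs with both multisets nonempty
(`mem_basisExponents_iff`): all reduced pairs, minus those with empty first and those with empty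
second multiset. This explains the subtracted term with factor 2 in the formulas. -/

/-- A magma in which left multiplications commute and right multiplications commute. -/
class IsBicommutative (B : Type*) [Mul B] : Prop where
  left_comm : ∀ a b c : B, a * (b * c) = b * (a * c)
  right_comm : ∀ a b c : B, (a * b) * c = (a * c) * b

/-! ### Exponents of nonassociative monomials -/

section Exponents

variable {X : Type*}

/-- The exponents of a nonassociative monomial seen as a left factor (first component) and as a
right factor (second component). Each exponent is a pair of multisets: the generators
acting by left multiplication and those acting by right multiplication. -/
def exponents : FreeMagma X →
    (Multiset X × Multiset X) × (Multiset X × Multiset X)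
  | .of x => (({x}, 0), (0, {x}))
  | .mul m n => ((exponents m).1 + (exponents n).2, (exponents m).1 + (exponents n).2)

/-- The exponent of a monomial used as a left factor. -/
def leftExp (m : FreeMagma X) : Multiset X × Multiset X := (exponents m).1

/-- The exponent of a monomial used as a right factor. -/
def rightExp (m : FreeMagma X) : Multiset X × Multiset X := (exponents m).2

@[simp] theorem leftExp_of (x : X) : leftExp (.of x) = ({x}, 0) := rfl
@[simp] theorem rightExp_of (x : X) : rightExp (.of x) = (0, {x}) := rfl
@[simp] theorem leftExp_mul (m n : FreeMagma X) : leftExp (m * n) = leftExp m + rightExp n := rfl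
@[simp] theorem rightExp_mul (m n : FreeMagma X) : rightExp (m * n) = leftExp m + rightExp n := rfl

theorem leftExp_fst_ne_zero (m : FreeMagma X) : (leftExp m).1 ≠ 0 := by
  induction m with
  | ih1 x => simp
  | ih2 m n hm hn => simp [hm]

theorem rightExp_snd_ne_zero (m : FreeMagma X) : (rightExp m).2 ≠ 0 := by
  induction m with
  | ih1 x => simp
  | ih2 m n hm hn => simp [hn]

theorem leftExp_mul_snd_ne_zero (m n : FreeMagma X) : (leftExp (m * n)).2 ≠ 0 := by
  simp [rightExp_snd_ne_zero]

/-- Starting from x y, right multiplication by a generator adds a v-letter and left multiplication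
adds a u-letter, because a product has the same exponent in both roles. -/
theorem exists_leftExp_mul_eq (x y : X) (s t : Multiset X) :
    ∃ m n : FreeMagma X, leftExp (m * n) = (x ::ₘ s, y ::ₘ t) := by
  induction s using Multiset.induction with
  | empty =>
    induction t using Multiset.induction with
    | empty => exact ⟨.of x, .of y, by simp⟩
    | cons a t ih =>
      obtain ⟨m, n, h⟩ := ih
      refine ⟨m * n, .of a, ?_⟩
      rw [leftExp_mul, h]
      simp [← Multiset.singleton_add, add_comm, add_left_comm, add_assoc]
  | cons a s ih =>
    obtain ⟨m, n, h⟩ := ih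
    refine ⟨.of a, m * n, ?_⟩
    rw [leftExp_mul, rightExp_mul, ← leftExp_mul, h]
    simp [← Multiset.singleton_add, add_left_comm]

end Exponents

/-! ### Normal forms in bicommutative magmas -/

section Magma

variable {B : Type*} [Mul B] [IsBicommutative B] {X : Type*}

theorem mul_mul_mul_comm_of_isBicommutative (a b x y : B) :
    (a * b) * (x * y) = (x * y) * (a * b) := by
  rw [IsBicommutative.left_comm (a * b) x y, IsBicommutative.right_comm a b y,
    IsBicommutative.left_comm x (a * y) b, IsBicommutative.right_comm a y (x * b),
    IsBicommutative.left_comm a x b, ← IsBicommutative.right_comm x y (a * b)]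

/-- The two sides equal (ab)(xy) and (xy)(ab), and products commute with each other. The middle
factor has to be a product, which is why the fold lemmas below carry an argument of the form `a *
b`. -/
theorem left_right_comm (x a b y : B) : x * ((a * b) * y) = (x * (a * b)) * y := by
  rw [IsBicommutative.left_comm x (a * b) y, IsBicommutative.right_comm x (a * b) y,
    mul_mul_mul_comm_of_isBicommutative]

instance (g : X → B) : LeftCommutative fun x b => g x * b :=
  ⟨fun _ _ _ => IsBicommutative.left_comm _ _ _⟩

instance (g : X → B) : LeftCommutative fun x b => b * g x :=
  ⟨fun _ _ _ => IsBicommutative.right_comm _ _ _⟩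

/-- Successive left multiplication by the elements of `s`. -/
def leftFold (g : X → B) (s : Multiset X) (b : B) : B := s.foldr (fun x b => g x * b) b

/-- Successive right multiplication by the elements of `s`. -/
def rightFold (g : X → B) (s : Multiset X) (b : B) : B := s.foldr (fun x b => b * g x) b

@[simp] theorem leftFold_zero (g : X → B) (b : B) : leftFold g 0 b = b := rfl
@[simp] theorem rightFold_zero (g : X → B) (b : B) : rightFold g 0 b = b := rfl

theorem leftFold_cons (g : X → B) (x : X) (s : Multiset X) (b : B) :
    leftFold g (x ::ₘ s) b = g x * leftFold g s b := Multiset.foldr_cons _ _ _ _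

theorem rightFold_cons (g : X → B) (x : X) (s : Multiset X) (b : B) :
    rightFold g (x ::ₘ s) b = rightFold g s b * g x := Multiset.foldr_cons _ _ _ _

theorem leftFold_cons' (g : X → B) (x : X) (s : Multiset X) (b : B) :
    leftFold g (x ::ₘ s) b = leftFold g s (g x * b) := by
  induction s using Multiset.induction with
  | empty => rw [leftFold_cons, leftFold_zero, leftFold_zero]
  | cons a s ih =>
    rw [Multiset.cons_swap, leftFold_cons, ih, leftFold_cons]

theorem rightFold_cons' (g : X → B) (x : X) (s : Multiset X) (b : B) :
    rightFold g (x ::ₘ s) b = rightFold g s (b * g x) := by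
  induction s using Multiset.induction with
  | empty => rw [rightFold_cons, rightFold_zero, rightFold_zero]
  | cons a s ih =>
    rw [Multiset.cons_swap, rightFold_cons, ih, rightFold_cons]

theorem exists_leftFold_eq_mul (g : X → B) (s : Multiset X) (a b : B) :
    ∃ c d, leftFold g s (a * b) = c * d := by
  induction s using Multiset.induction with
  | empty => exact ⟨a, b, rfl⟩
  | cons x s ih => exact ⟨_, _, leftFold_cons _ _ _ _⟩

theorem exists_rightFold_eq_mul (g : X → B) (s : Multiset X) (a b : B) :
    ∃ c d, rightFold g s (a * b) = c * d := by
  induction s using Multiset.induction with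
  | empty => exact ⟨a, b, rfl⟩
  | cons x s ih => exact ⟨_, _, rightFold_cons _ _ _ _⟩

theorem mul_rightFold (g : X → B) (t : Multiset X) (c a b : B) :
    c * rightFold g t (a * b) = rightFold g t (c * (a * b)) := by
  induction t using Multiset.induction with
  | empty => simp
  | cons x t ih =>
    obtain ⟨d, e, h⟩ := exists_rightFold_eq_mul g t a b
    rw [rightFold_cons, h, left_right_comm, ← h, ih, rightFold_cons]

theorem leftFold_mul (g : X → B) (s : Multiset X) (c a b : B) :
    leftFold g s (a * b) * c = leftFold g s ((a * b) * c) := by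
  induction s using Multiset.induction with
  | empty => simp
  | cons x s ih =>
    obtain ⟨d, e, h⟩ := exists_leftFold_eq_mul g s a b
    rw [leftFold_cons, h, ← left_right_comm, ← h, ih, leftFold_cons]

/-- The normal form `x₁ (⋯ (xₖ ((x y) y₁)) ⋯) yₗ` with `s = {x₁, …, xₖ}`, `t = {y₁, …, yₗ}`. -/
def normalForm (g : X → B) (x : X) (s : Multiset X) (y : X) (t : Multiset X) : B :=
  leftFold g s (rightFold g t (g x * g y))

theorem normalForm_cons_left (g : X → B) (x a : X) (s : Multiset X) (y : X) (t : Multiset X) :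
    normalForm g x (a ::ₘ s) y t = leftFold g s (rightFold g t (g a * (g x * g y))) := by
  rw [normalForm, leftFold_cons', mul_rightFold]

theorem normalForm_cons_right (g : X → B) (x a : X) (s : Multiset X) (y : X) (t : Multiset X) :
    normalForm g x s y (a ::ₘ t) = leftFold g s (rightFold g t ((g x * g y) * g a)) := by
  rw [normalForm, rightFold_cons']

/-- The choice of the innermost letters is immaterial: if they differ, each occurs among the outer
letters of the other form, can be moved next to the core, and a single use of left or right
commutativity exchanges them. -/
theorem normalForm_congr (g : X → B) {x x' y y' : X} {s s' t t' : Multiset X}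
    (hs : x ::ₘ s = x' ::ₘ s') (ht : y ::ₘ t = y' ::ₘ t') :
    normalForm g x s y t = normalForm g x' s' y' t' := by
  have h1 : normalForm g x s y t = normalForm g x' s' y t := by
    rcases Multiset.cons_eq_cons.1 hs with ⟨rfl, rfl⟩ | ⟨_, c, rfl, rfl⟩
    · rfl
    · rw [normalForm_cons_left, normalForm_cons_left, IsBicommutative.left_comm]
  rw [h1]
  rcases Multiset.cons_eq_cons.1 ht with ⟨rfl, rfl⟩ | ⟨_, c, rfl, rfl⟩
  · rfl
  · rw [normalForm_cons_right, normalForm_cons_right, IsBicommutative.right_comm]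

/-- `b` has a normal form with exponent `e`. -/
def IsNormalForm (g : X → B) (b : B) (e : Multiset X × Multiset X) : Prop :=
  ∃ x s y t, e = (x ::ₘ s, y ::ₘ t) ∧ b = normalForm g x s y t

theorem IsNormalForm.unique {g : X → B} {b b' : B} {e : Multiset X × Multiset X}
    (h : IsNormalForm g b e) (h' : IsNormalForm g b' e) : b = b' := by
  obtain ⟨x, s, y, t, rfl, rfl⟩ := h
  obtain ⟨x', s', y', t', he, rfl⟩ := h'
  rw [Prod.mk.injEq] at he
  exact normalForm_congr g he.1 he.2

theorem IsNormalForm.left_mul {g : X → B} {b : B} {e : Multiset X × Multiset X}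
    (h : IsNormalForm g b e) (a : X) : IsNormalForm g (g a * b) (({a}, 0) + e) := by
  obtain ⟨x, s, y, t, rfl, rfl⟩ := h
  refine ⟨x, a ::ₘ s, y, t, ?_, ?_⟩
  · simp [Multiset.cons_swap]
  · rw [normalForm, normalForm, leftFold_cons]

theorem IsNormalForm.right_mul {g : X → B} {b : B} {e : Multiset X × Multiset X}
    (h : IsNormalForm g b e) (a : X) : IsNormalForm g (b * g a) ((0, {a}) + e) := by
  obtain ⟨x, s, y, t, rfl, rfl⟩ := h
  refine ⟨x, s, y, a ::ₘ t, ?_, ?_⟩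
  · simp [Multiset.cons_swap]
  · obtain ⟨c, d, h⟩ := exists_rightFold_eq_mul g t (g x) (g y)
    rw [normalForm, normalForm, h, leftFold_mul, ← h, rightFold_cons]

variable (φ : FreeMagma X →ₙ* B)

/-- Multiplication by a product splits into one left and one right multiplication by its factors:
(mn)b = (mb)n and b(mn) = m(bn). Hence the two statements need a joint induction. -/
theorem IsNormalForm.map_mul (m : FreeMagma X) :
    (∀ b e, IsNormalForm (φ ∘ .of) b e → IsNormalForm (φ ∘ .of) (φ m * b) (leftExp m + e)) ∧
    (∀ b e, IsNormalForm (φ ∘ .of) b e → IsNormalForm (φ ∘ .of) (b * φ m) (rightExp m + e)) := by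
  induction m with
  | ih1 x => exact ⟨fun b e h => h.left_mul x, fun b e h => h.right_mul x⟩
  | ih2 m n hm hn =>
    constructor
    · intro b e h
      rw [_root_.map_mul, IsBicommutative.right_comm, leftExp_mul, add_comm (leftExp m), add_assoc]
      exact hn.2 _ _ (hm.1 _ _ h)
    · intro b e h
      rw [_root_.map_mul, IsBicommutative.left_comm, rightExp_mul, add_assoc]
      exact hm.1 _ _ (hn.2 _ _ h)

theorem isNormalForm_map (m n : FreeMagma X) :
    IsNormalForm (φ ∘ .of) (φ (m * n)) (leftExp (m * n)) := by
  -- A single generator has no normal form, its second multiset being empty, so the induction must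
  -- carry it as a separate alternative.
  suffices H : ∀ m, (∃ x, m = .of x) ∨ IsNormalForm (φ ∘ .of) (φ m) (leftExp m) by
    rcases H (m * n) with ⟨x, hx⟩ | h
    · cases hx
    · exact h
  intro m
  induction m with
  | ih1 x => exact .inl ⟨x, rfl⟩
  | ih2 m n hm hn =>
    right
    rcases hn with ⟨y, rfl⟩ | hn
    · rcases hm with ⟨x, rfl⟩ | hm
      · exact ⟨x, 0, y, 0, by simp, by simp [normalForm]⟩
      · rw [_root_.map_mul, leftExp_mul, add_comm]
        exact (IsNormalForm.map_mul φ _).2 _ _ hm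
    -- The left action yields the exponent `leftExp m + leftExp n`, whereas `rightExp n` is wanted;
    -- the two agree once `n` is known to be a product.
    · cases n with
      | of y =>
        obtain ⟨_, _, _, _, h, _⟩ := hn
        simp at h
      | mul n₁ n₂ =>
        rw [_root_.map_mul]
        exact (IsNormalForm.map_mul φ _).1 _ _ hn

theorem map_eq_of_leftExp_eq {m n : FreeMagma X} (h : leftExp m = leftExp n) : φ m = φ n := by
  cases m with
  | of x =>
    cases n with
    | of y => simp_all
    | mul a b => exact absurd (congrArg Prod.snd h).symm (leftExp_mul_snd_ne_zero a b)
  | mul a b =>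
    cases n with
    | of y => exact absurd (congrArg Prod.snd h) (leftExp_mul_snd_ne_zero a b)
    | mul c d => exact (isNormalForm_map φ a b).unique (h ▸ isNormalForm_map φ c d)

/-- If `Z` is absorbing and contains `z (z b)` and `(b z) z`, then it contains the image of every
monomial in which `z` occurs twice on the same side. -/
theorem map_mem_of_two_le_count [DecidableEq X] {Z : Set B}
    (hZ : ∀ a b, a ∈ Z ∨ b ∈ Z → a * b ∈ Z) {z : X}
    (hl : ∀ b, φ (.of z) * (φ (.of z) * b) ∈ Z) (hr : ∀ b, (b * φ (.of z)) * φ (.of z) ∈ Z)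
    {m n : FreeMagma X}
    (h : 2 ≤ (leftExp (m * n)).1.count z ∨ 2 ≤ (leftExp (m * n)).2.count z) :
    φ (m * n) ∈ Z := by
  have hL : ∀ s b, b ∈ Z → leftFold (φ ∘ .of) s b ∈ Z := by
    intro s b hb
    induction s using Multiset.induction with
    | empty => exact hb
    | cons x s ih => rw [leftFold_cons]; exact hZ _ _ (.inr ih)
  have hR : ∀ s b, b ∈ Z → rightFold (φ ∘ .of) s b ∈ Z := by
    intro s b hb
    induction s using Multiset.induction with
    | empty => exact hb
    | cons x s ih => rw [rightFold_cons]; exact hZ _ _ (.inl ih)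
  have key : ∀ s : Multiset X, 2 ≤ s.count z → ∃ t, s = z ::ₘ z ::ₘ t := by
    intro s hs
    obtain ⟨t, rfl⟩ := Multiset.exists_cons_of_mem (Multiset.count_pos.1 (by omega : 0 < s.count z))
    rw [Multiset.count_cons_self] at hs
    obtain ⟨u, rfl⟩ := Multiset.exists_cons_of_mem (Multiset.count_pos.1 (by omega : 0 < t.count z))
    exact ⟨u, rfl⟩
  obtain ⟨x, s, y, t, he, hb⟩ := isNormalForm_map φ m n
  rw [hb]
  rw [he] at h
  rcases h with h | h <;> obtain ⟨u, hu⟩ := key _ h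
  · rw [normalForm_congr _ hu rfl, normalForm_cons_left]
    exact hL _ _ (hR _ _ (hl _))
  · rw [normalForm_congr _ rfl hu, normalForm_cons_right]
    exact hL _ _ (hR _ _ (hr _))

end Magma

/-! ### The free supercommutative model -/

section SuperModel

variable {p q : ℕ}

/-- A monomial of the free supercommutative algebra on two copies of the generators. -/
abbrev Exponent (p q : ℕ) : Type := Multiset (Gen p q) × Multiset (Gen p q)

/-- The exponents of the odd generators. -/
def oddExp (e : Exponent p q) : Fin q ⊕ Fin q → ℕ :=
  Sum.elim (fun j => e.1.count (Sum.inr j)) (fun j => e.2.count (Sum.inr j))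

theorem oddExp_add (a b : Exponent p q) : oddExp (a + b) = oddExp a + oddExp b := by
  ext (j | j) <;> simp [oddExp]

/-- No odd generator occurs twice. -/
def IsReduced (e : Exponent p q) : Prop := ∀ i, oddExp e i ≤ 1

/-- The number of odd generators, modulo 2 the parity. -/
def oddCount (e : Exponent p q) : ℕ := ∑ i, oddExp e i

/-- The position of an odd generator. -/
def position : Fin q ⊕ Fin q → ℕ := Sum.elim (fun j => j) (fun j => q + j)

theorem position_injective : Function.Injective (position (q := q)) := by
  rintro (i | i) (j | j) h
  · simp only [position, Sum.elim_inl] at h; rw [Fin.ext h]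
  · simp only [position, Sum.elim_inl, Sum.elim_inr] at h; omega
  · simp only [position, Sum.elim_inl, Sum.elim_inr] at h; omega
  · simp only [position, Sum.elim_inr] at h; exact congrArg Sum.inr (Fin.ext (by omega))

/-- The number of transpositions of odd generators needed to sort a product of two monomials. -/
def inversions (a b : Exponent p q) : ℕ :=
  ∑ i, ∑ j, if position j < position i then oddExp a i * oddExp b j else 0

theorem inversions_add_left (a b c : Exponent p q) :
    inversions (a + b) c = inversions a c + inversions b c := by
  simp only [inversions, ← Finset.sum_add_distrib]
  refine Finset.sum_congr rfl fun i _ => Finset.sum_congr rfl fun j _ => ?_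
  split_ifs <;> simp [oddExp_add, add_mul]

theorem inversions_add_right (a b c : Exponent p q) :
    inversions a (b + c) = inversions a b + inversions a c := by
  simp only [inversions, ← Finset.sum_add_distrib]
  refine Finset.sum_congr rfl fun i _ => Finset.sum_congr rfl fun j _ => ?_
  split_ifs <;> simp [oddExp_add, mul_add]

theorem IsReduced.left {a b : Exponent p q} (h : IsReduced (a + b)) : IsReduced a := fun i => by
  have := h i
  simp only [oddExp_add, Pi.add_apply] at this
  omega

theorem IsReduced.right {a b : Exponent p q} (h : IsReduced (a + b)) : IsReduced b :=
  (add_comm a b ▸ h).left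

/-- A pair formed by an odd letter of `a` and one of `b` is an inversion in exactly one of the two
orders; equal letters are excluded by reducedness. -/
theorem inversions_comm {a b : Exponent p q} (h : IsReduced (a + b)) :
    inversions a b + inversions b a = oddCount a * oddCount b := by
  rw [inversions, inversions, Finset.sum_comm (f := fun i j =>
    if position j < position i then oddExp b i * oddExp a j else 0), oddCount, oddCount,
    Finset.sum_mul_sum, ← Finset.sum_add_distrib]
  refine Finset.sum_congr rfl fun i _ => ?_
  rw [← Finset.sum_add_distrib]
  refine Finset.sum_congr rfl fun j _ => ?_
  rcases lt_trichotomy (position i) (position j) with hij | hij | hij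
  · simp [hij, hij.le, mul_comm]
  · obtain rfl := position_injective hij
    have := h i
    simp only [oddExp_add, Pi.add_apply] at this
    have : oddExp a i = 0 ∨ oddExp b i = 0 := by omega
    rcases this with h | h <;> simp [h]
  · simp [hij, hij.le]

variable (K : Type*) [Field K]

open Classical in
/-- The structure constant of the free supercommutative algebra. -/
def structConst (a b : Exponent p q) : K :=
  if IsReduced (a + b) then (-1) ^ inversions a b else 0

variable {K}

theorem structConst_ne_zero {a b : Exponent p q} (h : IsReduced (a + b)) :
    structConst K a b ≠ 0 := by
  simp [structConst, h]

theorem structConst_left_comm (a b d : Exponent p q) :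
    structConst K b d * structConst K a (b + d) =
      (-1) ^ (oddCount a * oddCount b) * (structConst K a d * structConst K b (a + d)) := by
  by_cases h : IsReduced (a + (b + d))
  · have h' : IsReduced (b + (a + d)) := by rwa [add_left_comm]
    have hab : IsReduced (a + b) := by rw [← add_assoc] at h; exact h.left
    simp only [structConst, h, h', h.right, h'.right, if_true, ← pow_add,
      inversions_add_right]
    -- The two exponents of -1 differ by twice `inversions b a`, so comparing them modulo 2
    -- suffices.
    rw [neg_one_pow_eq_pow_mod_two, ← inversions_comm hab, neg_one_pow_eq_pow_mod_two (n := _ + _)]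
    congr 1
    omega
  · have h' : ¬ IsReduced (b + (a + d)) := by rwa [add_left_comm]
    simp [structConst, h, h']

theorem structConst_right_comm (a b d : Exponent p q) :
    structConst K a b * structConst K (a + b) d =
      (-1) ^ (oddCount b * oddCount d) * (structConst K a d * structConst K (a + d) b) := by
  by_cases h : IsReduced (a + b + d)
  · have h' : IsReduced (a + d + b) := by rwa [add_right_comm]
    have hbd : IsReduced (b + d) := by rw [add_assoc] at h; exact h.right
    simp only [structConst, h, h', h.left, h'.left, if_true, ← pow_add,
      inversions_add_left]
    rw [neg_one_pow_eq_pow_mod_two, ← inversions_comm hbd, neg_one_pow_eq_pow_mod_two (n := _ + _)]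
    congr 1
    omega
  · have h' : ¬ IsReduced (a + d + b) := by rwa [add_right_comm]
    simp [structConst, h, h']

variable (K p q) in
/-- The multiplication of the free supercommutative algebra, given on the basis of monomials. -/
def superMul : (Exponent p q →₀ K) →ₗ[K] (Exponent p q →₀ K) →ₗ[K] (Exponent p q →₀ K) :=
  Finsupp.lsum K fun a => LinearMap.toSpanSingleton K _
    (Finsupp.lsum K fun b => LinearMap.toSpanSingleton K _
      (Finsupp.single (a + b) (structConst K a b)))

theorem superMul_single (a b : Exponent p q) (r s : K) :
    superMul p q K (Finsupp.single a r) (Finsupp.single b s) =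
      Finsupp.single (a + b) (r * s * structConst K a b) := by
  simp only [superMul, Finsupp.lsum_single, LinearMap.toSpanSingleton_apply, LinearMap.smul_apply,
    Finsupp.smul_single, smul_eq_mul, mul_assoc]

variable (K) in
/-- The scalar of the image of a nonassociative monomial in the free supercommutative algebra. -/
def coeff : FreeMagma (Gen p q) → K
  | .of _ => 1
  | .mul m n => coeff m * coeff n * structConst K (leftExp m) (rightExp n)

@[simp] theorem coeff_of (x : Gen p q) : coeff K (.of x) = 1 := rfl
@[simp] theorem coeff_mul (m n : FreeMagma (Gen p q)) :
    coeff K (m * n) = coeff K m * coeff K n * structConst K (leftExp m) (rightExp n) := rfl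

theorem coeff_ne_zero (m : FreeMagma (Gen p q)) :
    (IsReduced (leftExp m) → coeff K m ≠ 0) ∧ (IsReduced (rightExp m) → coeff K m ≠ 0) := by
  induction m with
  | ih1 x => simp
  | ih2 m n hm hn =>
    have : IsReduced (leftExp m + rightExp n) → coeff K (m * n) ≠ 0 := fun h =>
      mul_ne_zero (mul_ne_zero (hm.1 h.left) (hn.2 h.right)) (structConst_ne_zero h)
    exact ⟨this, this⟩

variable (K) in
/-- The linear map with the value `coeff m` times the monomial `w m` at a monomial `m`. -/
def monomialMap (w : FreeMagma (Gen p q) → Exponent p q) :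
    FreeNonassoc K p q →ₗ[K] (Exponent p q →₀ K) :=
  (Finsupp.lsum K fun m => LinearMap.toSpanSingleton K _ (Finsupp.single (w m) (coeff K m))) ∘ₗ
    (MonoidAlgebra.coeffLinearEquiv K).toLinearMap

theorem monomialMap_ofMagma (w : FreeMagma (Gen p q) → Exponent p q) (m : FreeMagma (Gen p q)) :
    monomialMap K w (MonoidAlgebra.ofMagma K _ m) = Finsupp.single (w m) (coeff K m) := by
  simp [monomialMap]

theorem span_range_ofMagma :
    Submodule.span K (Set.range (MonoidAlgebra.ofMagma K (FreeMagma (Gen p q)))) = ⊤ := by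
  rw [eq_top_iff]
  rintro f -
  induction f using MonoidAlgebra.induction_linear with
  | zero => exact zero_mem _
  | add f g hf hg => exact add_mem hf hg
  | single m r =>
    have : (MonoidAlgebra.single m r : FreeNonassoc K p q) = r • MonoidAlgebra.ofMagma K _ m := by
      simp
    rw [this]
    exact Submodule.smul_mem _ _ (Submodule.subset_span ⟨m, rfl⟩)

/-- Applies to both `leftExp` and `rightExp`: the two images differ on generators but agree on
products. -/
theorem monomialMap_mul {w : FreeMagma (Gen p q) → Exponent p q}
    (hw : ∀ m n, w (m * n) = leftExp m + rightExp n) (f g : FreeNonassoc K p q) :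
    monomialMap K w (f * g) =
      superMul p q K (monomialMap K leftExp f) (monomialMap K rightExp g) := by
  have hf : f ∈ Submodule.span K (Set.range (MonoidAlgebra.ofMagma K (FreeMagma (Gen p q)))) := by
    simp [span_range_ofMagma]
  have hg : g ∈ Submodule.span K (Set.range (MonoidAlgebra.ofMagma K (FreeMagma (Gen p q)))) := by
    simp [span_range_ofMagma]
  induction hf, hg using Submodule.span_induction₂ with
  | mem_mem x y hx hy =>
    obtain ⟨m, rfl⟩ := hx
    obtain ⟨n, rfl⟩ := hy
    rw [← map_mul, monomialMap_ofMagma, monomialMap_ofMagma, monomialMap_ofMagma, superMul_single,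
      hw, coeff_mul]
  | zero_left y hy => simp
  | zero_right x hx => simp
  | add_left x y z hx hy hz h1 h2 => simp [add_mul, h1, h2]
  | add_right x y z hx hy hz h1 h2 => simp [mul_add, h1, h2]
  | smul_left r x y hx hy h =>
    rw [smul_mul_assoc, map_smul, h, map_smul, map_smul, LinearMap.smul_apply]
  | smul_right r x y hx hy h => rw [mul_smul_comm, map_smul, h, map_smul, map_smul]

theorem count_leftExp_rightExp (x : Gen p q) (m : FreeMagma (Gen p q)) :
    (leftExp m).1.count x + (leftExp m).2.count x = degree x m ∧
    (rightExp m).1.count x + (rightExp m).2.count x = degree x m := by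
  induction m with
  | ih1 y =>
    have : degree x (.of y) = if y = x then 1 else 0 := rfl
    simp [this, Multiset.count_singleton, eq_comm]
  | ih2 m n hm hn =>
    have : degree x (m * n) = degree x m + degree x n := rfl
    simp only [leftExp_mul, rightExp_mul, this, Prod.fst_add, Prod.snd_add, Multiset.count_add,
      and_self]
    omega

theorem oddCount_leftExp (m : FreeMagma (Gen p q)) : oddCount (leftExp m) = oddDegree m := by
  simp only [oddCount, oddExp, oddDegree, Fintype.sum_sum_type, Sum.elim_inl, Sum.elim_inr,
    ← Finset.sum_add_distrib, (count_leftExp_rightExp _ m).1]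

theorem oddCount_rightExp (m : FreeMagma (Gen p q)) : oddCount (rightExp m) = oddDegree m := by
  simp only [oddCount, oddExp, oddDegree, Fintype.sum_sum_type, Sum.elim_inl, Sum.elim_inr,
    ← Finset.sum_add_distrib, (count_leftExp_rightExp _ m).2]

theorem sign_natCast (m n : ℕ) : sign K (m : ZMod 2) (n : ZMod 2) = (-1) ^ (m * n) := by
  rw [sign, ZMod.val_natCast, ZMod.val_natCast, neg_one_pow_eq_pow_mod_two,
    neg_one_pow_eq_pow_mod_two (n := m * n), Nat.mul_mod m n]

/-- By trilinearity it is enough to treat monomials, where moving u(a) past u(b) costs the sign of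
their parities. -/
theorem superMul_left_comm {i j k : ZMod 2} {a b c : FreeNonassoc K p q}
    (ha : a ∈ parityPart K p q i) (hb : b ∈ parityPart K p q j) (hc : c ∈ parityPart K p q k) :
    superMul p q K (monomialMap K leftExp a)
        (superMul p q K (monomialMap K leftExp b) (monomialMap K rightExp c)) =
      sign K i j • superMul p q K (monomialMap K leftExp b)
        (superMul p q K (monomialMap K leftExp a) (monomialMap K rightExp c)) := by
  induction ha using Submodule.span_induction with
  | zero => simp
  | add x y hx hy h1 h2 => simp [h1, h2]
  | smul r x hx h => simp [h, smul_comm r]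
  | mem a ha =>
  induction hb using Submodule.span_induction with
  | zero => simp
  | add x y hx hy h1 h2 => simp [h1, h2]
  | smul r x hx h => simp [h, smul_comm r]
  | mem b hb =>
  induction hc using Submodule.span_induction with
  | zero => simp
  | add x y hx hy h1 h2 => simp [h1, h2]
  | smul r x hx h => simp [h, smul_comm r]
  | mem c hc =>
  obtain ⟨m, rfl, rfl⟩ := ha
  obtain ⟨n, rfl, rfl⟩ := hb
  obtain ⟨o, -, rfl⟩ := hc
  simp only [monomialMap_ofMagma, superMul_single, sign_natCast, Finsupp.smul_single, smul_eq_mul]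
  rw [add_left_comm]
  congr 1
  have := structConst_left_comm (K := K) (leftExp m) (leftExp n) (rightExp o)
  rw [oddCount_leftExp, oddCount_leftExp] at this
  linear_combination (coeff K m * coeff K n * coeff K o) * this

theorem superMul_right_comm {i j k : ZMod 2} {a b c : FreeNonassoc K p q}
    (ha : a ∈ parityPart K p q i) (hb : b ∈ parityPart K p q j) (hc : c ∈ parityPart K p q k) :
    superMul p q K (superMul p q K (monomialMap K leftExp a) (monomialMap K rightExp b))
        (monomialMap K rightExp c) =
      sign K j k • superMul p q K (superMul p q K (monomialMap K leftExp a)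
        (monomialMap K rightExp c)) (monomialMap K rightExp b) := by
  induction ha using Submodule.span_induction with
  | zero => simp
  | add x y hx hy h1 h2 => simp [h1, h2]
  | smul r x hx h => simp [h, smul_comm r]
  | mem a ha =>
  induction hb using Submodule.span_induction with
  | zero => simp
  | add x y hx hy h1 h2 => simp [h1, h2]
  | smul r x hx h => simp [h, smul_comm r]
  | mem b hb =>
  induction hc using Submodule.span_induction with
  | zero => simp
  | add x y hx hy h1 h2 => simp [h1, h2]
  | smul r x hx h => simp [h, smul_comm r]
  | mem c hc =>
  obtain ⟨m, -, rfl⟩ := ha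
  obtain ⟨n, rfl, rfl⟩ := hb
  obtain ⟨o, rfl, rfl⟩ := hc
  simp only [monomialMap_ofMagma, superMul_single, sign_natCast, Finsupp.smul_single, smul_eq_mul]
  rw [add_right_comm]
  congr 1
  have := structConst_right_comm (K := K) (leftExp m) (rightExp n) (rightExp o)
  rw [oddCount_rightExp, oddCount_rightExp] at this
  linear_combination (coeff K m * coeff K n * coeff K o) * this

theorem identityIdeal_le_ker_monomialMap :
    identityIdeal K p q ≤ LinearMap.ker (monomialMap K leftExp) := by
  -- The image of a product involves the left image of one factor and the right image of the other,
  -- so the two kernels are intersected to obtain an ideal.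
  suffices h : identityIdeal K p q ≤
      LinearMap.ker (monomialMap K leftExp) ⊓ LinearMap.ker (monomialMap K rightExp) from
    h.trans inf_le_left
  refine sInf_le ⟨?_, ?_⟩
  · rintro f ⟨i, j, k, a, ha, b, hb, c, hc, rfl | rfl⟩
    · simp [monomialMap_mul leftExp_mul, monomialMap_mul rightExp_mul,
        superMul_left_comm ha hb hc]
    · simp [monomialMap_mul leftExp_mul, monomialMap_mul rightExp_mul,
        superMul_right_comm ha hb hc]
  · rintro a f ⟨h1, h2⟩
    simp only [SetLike.mem_coe, LinearMap.mem_ker] at h1 h2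
    simp [monomialMap_mul leftExp_mul, monomialMap_mul rightExp_mul, h1, h2]

variable (K p q) in
/-- The linear map induced on the free bicommutative superalgebra, with values in the free
supercommutative algebra on two copies of the generators. -/
def toSuper : FreeBicomm K p q →ₗ[K] (Exponent p q →₀ K) :=
  (identityIdeal K p q).liftQ (monomialMap K leftExp) identityIdeal_le_ker_monomialMap

theorem toFree_ofMagma (m : FreeMagma (Gen p q)) :
    toFree K p q (MonoidAlgebra.ofMagma K _ m) = monomial K p q m := by
  induction m with
  | ih1 x => rfl
  | ih2 m n hm hn => rw [map_mul, map_mul (monomial K p q), toFree_mul, hm, hn]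

theorem toSuper_monomial (m : FreeMagma (Gen p q)) :
    toSuper p q K (monomial K p q m) = Finsupp.single (leftExp m) (coeff K m) := by
  rw [← toFree_ofMagma, ← monomialMap_ofMagma]
  rfl

end SuperModel

/-! ### Monomials up to sign and bases of components -/

section Monomials

variable {p q : ℕ} {K : Type*} [Field K]

theorem ofMagma_mem_parityPart (m : FreeMagma (Gen p q)) :
    MonoidAlgebra.ofMagma K _ m ∈ parityPart K p q (oddDegree m : ℕ) :=
  Submodule.subset_span ⟨m, rfl, rfl⟩

theorem toFree_eq_zero_of_mem_identityValues {f : FreeNonassoc K p q}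
    (hf : f ∈ identityValues K p q) : toFree K p q f = 0 :=
  (Submodule.Quotient.mk_eq_zero _).2 ((Submodule.mem_sInf).2 fun _ hI => hI.1 hf)

theorem monomial_left_comm (a b c : FreeMagma (Gen p q)) :
    monomial K p q (a * (b * c)) =
      (-1 : K) ^ (oddDegree a * oddDegree b) • monomial K p q (b * (a * c)) := by
  have h := toFree_eq_zero_of_mem_identityValues (K := K)
    ⟨_, _, _, _, ofMagma_mem_parityPart a, _, ofMagma_mem_parityPart b,
      _, ofMagma_mem_parityPart c, .inl rfl⟩
  simpa only [map_sub, map_smul, toFree_mul, toFree_ofMagma, sign_natCast, sub_eq_zero,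
    ← map_mul (monomial K p q)] using h

theorem monomial_right_comm (a b c : FreeMagma (Gen p q)) :
    monomial K p q ((a * b) * c) =
      (-1 : K) ^ (oddDegree b * oddDegree c) • monomial K p q ((a * c) * b) := by
  have h := toFree_eq_zero_of_mem_identityValues (K := K)
    ⟨_, _, _, _, ofMagma_mem_parityPart a, _, ofMagma_mem_parityPart b,
      _, ofMagma_mem_parityPart c, .inr rfl⟩
  simpa only [map_sub, map_smul, toFree_mul, toFree_ofMagma, sign_natCast, sub_eq_zero,
    ← map_mul (monomial K p q)] using h

variable (p q K) in
/-- Two monomials are congruent if their values agree up to sign. -/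
def signCon : Con (FreeMagma (Gen p q)) where
  r m n := monomial K p q m = monomial K p q n ∨ monomial K p q m = -monomial K p q n
  iseqv :=
    { refl := fun _ => .inl rfl
      symm := by
        rintro m n (h | h)
        · exact .inl h.symm
        · exact .inr (by rw [h, neg_neg])
      trans := by
        rintro l m n (h | h) (h' | h')
        · exact .inl (h.trans h')
        · exact .inr (h.trans h')
        · exact .inr (by rw [h, h'])
        · exact .inl (by rw [h, h', neg_neg]) }
  mul' := by
    rintro a b c d (h | h) (h' | h') <;> simp [h, h']

theorem signCon_of_eq_smul {m n : FreeMagma (Gen p q)} {e : ℕ}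
    (h : monomial K p q m = (-1 : K) ^ e • monomial K p q n) : signCon p q K m n := by
  rcases neg_one_pow_eq_or K e with he | he
  · exact .inl (by rw [h, he, one_smul])
  · exact .inr (by rw [h, he, neg_one_smul])

instance : IsBicommutative (signCon p q K).Quotient where
  left_comm a b c := by
    induction a using Con.induction_on with | _ a =>
    induction b using Con.induction_on with | _ b =>
    induction c using Con.induction_on with | _ c =>
    exact (Con.eq _).2 (signCon_of_eq_smul (monomial_left_comm a b c))
  right_comm a b c := by
    induction a using Con.induction_on with | _ a =>
    induction b using Con.induction_on with | _ b =>
    induction c using Con.induction_on with | _ c =>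
    exact (Con.eq _).2 (signCon_of_eq_smul (monomial_right_comm a b c))

variable (p q K) in
/-- The quotient map of `signCon`. -/
def signConMk : FreeMagma (Gen p q) →ₙ* (signCon p q K).Quotient where
  toFun m := m
  map_mul' _ _ := rfl

theorem monomial_eq_or_eq_neg {m n : FreeMagma (Gen p q)} (h : leftExp m = leftExp n) :
    monomial K p q m = monomial K p q n ∨ monomial K p q m = -monomial K p q n :=
  (Con.eq _).1 (map_eq_of_leftExp_eq (signConMk p q K) h)

theorem eq_zero_of_eq_neg_one_smul (hK : ringChar K ≠ 2) {V : Type*} [AddCommGroup V] [Module K V]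
    {v : V} (h : v = (-1 : K) • v) : v = 0 := by
  have h2 : (2 : K) • v = 0 := by
    rw [two_smul]
    nth_rewrite 2 [h]
    simp
  exact (smul_eq_zero.1 h2).resolve_left (Ring.two_ne_zero hK)

theorem oddDegree_of_inr (j : Fin q) :
    oddDegree (.of (Sum.inr j) : FreeMagma (Gen p q)) = 1 := by
  simp [oddDegree, degree]

theorem monomial_eq_zero (hK : ringChar K ≠ 2) {m : FreeMagma (Gen p q)}
    (hm : ¬ IsReduced (leftExp m)) : monomial K p q m = 0 := by
  have hcount : ∃ j : Fin q, 2 ≤ (leftExp m).1.count (Sum.inr j) ∨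
      2 ≤ (leftExp m).2.count (Sum.inr j) := by
    simp only [IsReduced, not_forall, not_le] at hm
    obtain ⟨j | j, hj⟩ := hm
    · exact ⟨j, .inl hj⟩
    · exact ⟨j, .inr hj⟩
  obtain ⟨j, hj⟩ := hcount
  cases m with
  | of x =>
    have := Multiset.count_le_card (Sum.inr j) ({x} : Multiset (Gen p q))
    simp at this hj
    omega
  | mul m n =>
    -- The classes of vanishing monomials. Vanishing is insensitive to sign, so one vanishing
    -- representative makes the whole class vanish.
    let Z : Set (signCon p q K).Quotient := {b | ∃ m, signConMk p q K m = b ∧ monomial K p q m = 0}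
    have hZ : ∀ a b, a ∈ Z ∨ b ∈ Z → a * b ∈ Z := by
      intro a b
      induction a using Con.induction_on with | _ a =>
      induction b using Con.induction_on with | _ b =>
      rintro (⟨c, hc, h⟩ | ⟨c, hc, h⟩)
      · exact ⟨c * b, by rw [map_mul, hc]; rfl, by rw [map_mul, h, zero_mul]⟩
      · exact ⟨a * c, by rw [map_mul, hc]; rfl, by rw [map_mul, h, mul_zero]⟩
    have hl : ∀ b, signConMk p q K (.of (Sum.inr j)) * (signConMk p q K (.of (Sum.inr j)) * b) ∈ Z := by
      intro b
      induction b using Con.induction_on with | _ b =>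
      refine ⟨.of (Sum.inr j) * (.of (Sum.inr j) * b), rfl, eq_zero_of_eq_neg_one_smul hK ?_⟩
      simpa [oddDegree_of_inr] using
        monomial_left_comm (K := K) (.of (Sum.inr j)) (.of (Sum.inr j)) b
    have hr : ∀ b, b * signConMk p q K (.of (Sum.inr j)) * signConMk p q K (.of (Sum.inr j)) ∈ Z := by
      intro b
      induction b using Con.induction_on with | _ b =>
      refine ⟨b * .of (Sum.inr j) * .of (Sum.inr j), rfl, eq_zero_of_eq_neg_one_smul hK ?_⟩
      simpa [oddDegree_of_inr] using
        monomial_right_comm (K := K) b (.of (Sum.inr j)) (.of (Sum.inr j))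
    obtain ⟨n', hn, h0⟩ := map_mem_of_two_le_count (signConMk p q K) hZ hl hr hj
    rcases (Con.eq _).1 hn with h | h
    · exact h.symm.trans h0
    · exact neg_eq_zero.1 (h.symm.trans h0)

/-- The exponents in `D` of the nonzero monomials. -/
def basisExponents (D : Set (Exponent p q)) : Set (Exponent p q) :=
  {e | e ∈ D ∧ IsReduced e ∧ ∃ m, leftExp m = e}

/-- One monomial chosen per reduced exponent gives a basis: other monomials vanish or agree with a
chosen one up to sign, and `toSuper` detects independence. -/
theorem hasDim_span_monomial (hK : ringChar K ≠ 2) {D : Set (Exponent p q)}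
    (hD : (basisExponents D).Finite) :
    HasDim K (Submodule.span K {f | ∃ m, leftExp m ∈ D ∧ f = monomial K p q m})
      (basisExponents D).ncard := by
  have : Fintype (basisExponents D) := hD.fintype
  choose N hN using fun e : basisExponents D => e.2.2.2
  have hspan : Submodule.span K {f | ∃ m, leftExp m ∈ D ∧ f = monomial K p q m} =
      Submodule.span K (Set.range fun e => monomial K p q (N e)) := by
    refine le_antisymm (Submodule.span_le.2 ?_) (Submodule.span_mono ?_)
    · rintro _ ⟨m, hm, rfl⟩
      by_cases hr : IsReduced (leftExp m)
      · have he := hN ⟨leftExp m, hm, hr, m, rfl⟩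
        have hmem := Submodule.subset_span (R := K) (Set.mem_range_self
          (f := fun e => monomial K p q (N e)) ⟨leftExp m, hm, hr, m, rfl⟩)
        rcases monomial_eq_or_eq_neg (K := K) he.symm with h | h
        · rw [SetLike.mem_coe, h]; exact hmem
        · rw [SetLike.mem_coe, h]; exact neg_mem hmem
      · rw [monomial_eq_zero hK hr]; exact zero_mem _
    · rintro _ ⟨e, rfl⟩
      exact ⟨N e, by rw [hN]; exact e.2.1, rfl⟩
  have hli : LinearIndependent K fun e => monomial K p q (N e) := by
    refine LinearIndependent.of_comp (toSuper p q K) ?_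
    have : (toSuper p q K ∘ fun e => monomial K p q (N e)) = fun e : basisExponents D =>
        (Finsupp.single e.1 (coeff K (N e)) : Exponent p q →₀ K) := by
      ext1 e
      rw [Function.comp_apply, toSuper_monomial, hN]
    rw [this]
    have hu : ∀ e : basisExponents D, coeff K (N e) ≠ 0 := fun e =>
      (coeff_ne_zero _).1 (by rw [hN]; exact e.2.2.1)
    -- The images are standard basis vectors at distinct exponents, rescaled by the nonzero
    -- coefficients.
    have h1 := ((Finsupp.basisSingleOne (R := K) (ι := Exponent p q)).linearIndependent.comp
      (fun e : basisExponents D => e.1) Subtype.val_injective).units_smul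
        (fun e => Units.mk0 _ (hu e))
    convert h1 using 1
    ext1 e
    simp [Units.smul_def]
  rw [hspan]
  refine ⟨FiniteDimensional.span_of_finite K (Set.finite_range _), ?_⟩
  rw [finrank_span_eq_card hli, Set.ncard_eq_toFinset_card', Set.toFinset_card]

end Monomials

/-! ### Elementary counts of degree functions -/

section Counting

/-- Stars and bars. For empty `ι` and `k = 0`, truncated subtraction gives `(0 - 1).choose 0 = 1`,
in accordance with the convention for the binomial coefficient of -1 over 0. -/
theorem ncard_sum_eq (ι : Type*) [Fintype ι] (k : ℕ) :
    {u : ι → ℕ | ∑ i, u i = k}.ncard = (Fintype.card ι + k - 1).choose k := by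
  classical
  have : {u : ι → ℕ | ∑ i, u i = k} =
      Finsupp.equivFunOnFinite '' (Finset.finsuppAntidiag (Finset.univ : Finset ι) k : Set (ι →₀ ℕ)) := by
    ext u
    simp only [Set.mem_ofPred_eq, Equiv.image_eq_preimage_symm, Set.mem_preimage, Finset.mem_coe,
      Finset.mem_finsuppAntidiag, Finset.subset_univ, and_true]
    rfl
  rw [this, Set.ncard_image_of_injective _ Finsupp.equivFunOnFinite.injective,
    Set.ncard_coe_finset, Finset.card_finsuppAntidiag_nat_eq_choose, Finset.card_univ]

theorem ncard_sum_eq_of_le_one (κ : Type*) [Fintype κ] (l : ℕ) :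
    {v : κ → ℕ | ∑ j, v j = l ∧ ∀ j, v j ≤ 1}.ncard = (Fintype.card κ).choose l := by
  classical
  have : {v : κ → ℕ | ∑ j, v j = l ∧ ∀ j, v j ≤ 1} =
      (fun (s : Finset κ) (j : κ) => if j ∈ s then 1 else 0) ''
        (Finset.powersetCard l (Finset.univ : Finset κ) : Set (Finset κ)) := by
    ext v
    simp only [Set.mem_ofPred_eq, Set.mem_image, Finset.mem_coe, Finset.mem_powersetCard,
      Finset.subset_univ, true_and]
    constructor
    · rintro ⟨h, h1⟩
      have hv : (fun j => if j ∈ Finset.univ.filter (fun j => v j = 1) then 1 else 0) = v := by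
        ext j
        have := h1 j
        simp only [Finset.mem_filter, Finset.mem_univ, true_and]
        split_ifs <;> omega
      refine ⟨_, ?_, hv⟩
      rw [← h, ← hv, Finset.card_eq_sum_ones, ← Finset.sum_filter]
      simp
    · rintro ⟨s, hs, rfl⟩
      refine ⟨by simpa using hs, fun j => ?_⟩
      dsimp only
      split_ifs <;> simp
  rw [this, Set.ncard_image_of_injective, Set.ncard_coe_finset, Finset.card_powersetCard,
    Finset.card_univ]
  intro s t hst
  ext j
  have := congrFun hst j
  by_cases h1 : j ∈ s <;> by_cases h2 : j ∈ t <;> simp_all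

theorem ncard_bidegree_eq (ι κ : Type*) [Fintype ι] [Fintype κ] (k l : ℕ) :
    {h : ι ⊕ κ → ℕ | (∑ i, h (.inl i) = k ∧ ∑ j, h (.inr j) = l) ∧ ∀ j, h (.inr j) ≤ 1}.ncard =
      (Fintype.card ι + k - 1).choose k * (Fintype.card κ).choose l := by
  rw [← ncard_sum_eq, ← ncard_sum_eq_of_le_one, ← Set.ncard_prod,
    ← Set.ncard_image_of_injective _ (Equiv.sumArrowEquivProdArrow ι κ ℕ).injective]
  congr 1
  ext ⟨u, v⟩
  simp [Equiv.image_eq_preimage_symm, and_assoc]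

/-- The contribution of one odd generator of degree `l`: its occurrences are split between the two
sides, at most one on each, in 1, 2, 1 ways for `l = 0, 1, 2` and in none beyond. -/
theorem card_filter_antidiagonal (l : ℕ) :
    (((Finset.HasAntidiagonal.antidiagonal l).filter fun x => x.1 ≤ 1 ∧ x.2 ≤ 1).card : ℤ) =
      kdelta 2 l + 2 * kdelta 1 l + kdelta 0 l := by
  match l with
  | 0 => rfl
  | 1 => rfl
  | 2 => rfl
  | l + 3 =>
    rw [Finset.filter_false_of_mem]
    · simp [kdelta]
    · intro x hx
      rw [Finset.HasAntidiagonal.mem_antidiagonal] at hx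
      omega

theorem kdelta_one_add_kdelta_zero (l : ℕ) :
    kdelta 1 l + kdelta 0 l = if l ≤ 1 then 1 else 0 := by
  match l with
  | 0 => rfl
  | 1 => rfl
  | l + 2 => simp [kdelta]

end Counting

/-! ### Counting the exponents of a component -/

section Exponents

variable {p q : ℕ}

/-- The exponents whose multidegree lies in `D`. -/
def exponentsOfDegree (D : Set (Gen p q → ℕ)) : Set (Exponent p q) :=
  {e | (fun x => e.1.count x + e.2.count x) ∈ D}

/-- The pairs of reduced multidegrees whose sum lies in `D`. -/
def reducedPairs (D : Set (Gen p q → ℕ)) : Set ((Gen p q → ℕ) × (Gen p q → ℕ)) :=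
  {f | f.1 + f.2 ∈ D ∧ (∀ j, f.1 (.inr j) ≤ 1) ∧ ∀ j, f.2 (.inr j) ≤ 1}

/-- The reduced multidegrees in `D`. -/
def reducedDegrees (D : Set (Gen p q → ℕ)) : Set (Gen p q → ℕ) :=
  {f | f ∈ D ∧ ∀ j, f (.inr j) ≤ 1}

theorem finite_reducedPairs {D : Set (Gen p q → ℕ)} (hD : D.Finite) :
    (reducedPairs D).Finite := by
  refine (hD.biUnion fun d _ => (Set.finite_Icc (0 : Gen p q → ℕ) d).prod
    (Set.finite_Icc (0 : Gen p q → ℕ) d)).subset ?_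
  rintro ⟨f, g⟩ ⟨h, -⟩
  refine Set.mem_biUnion h ⟨⟨zero_le, ?_⟩, ⟨zero_le, ?_⟩⟩
  · exact le_self_add
  · exact le_add_self

/-- The bijection between exponents and pairs of multidegrees. -/
def countEquiv (p q : ℕ) : Exponent p q ≃ (Gen p q → ℕ) × (Gen p q → ℕ) :=
  Equiv.prodCongr (Multiset.toFinsupp.toEquiv.trans Finsupp.equivFunOnFinite)
    (Multiset.toFinsupp.toEquiv.trans Finsupp.equivFunOnFinite)

theorem countEquiv_apply (e : Exponent p q) :
    countEquiv p q e = (fun x => e.1.count x, fun x => e.2.count x) := rfl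

theorem isReduced_iff (e : Exponent p q) :
    IsReduced e ↔ (∀ j, e.1.count (.inr j) ≤ 1) ∧ ∀ j, e.2.count (.inr j) ≤ 1 := by
  simp [IsReduced, oddExp, Sum.forall]

/-- The degree bound rules out single generators, whose second multiset is empty; among products
every pair of nonempty multisets occurs. -/
theorem mem_basisExponents_iff {D : Set (Gen p q → ℕ)} (hD : ∀ d ∈ D, 1 < ∑ x, d x)
    (e : Exponent p q) : e ∈ basisExponents (exponentsOfDegree D) ↔
      e ∈ exponentsOfDegree D ∧ IsReduced e ∧ e.1 ≠ 0 ∧ e.2 ≠ 0 := by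
  refine and_congr_right fun he => and_congr_right fun _ => ⟨?_, ?_⟩
  · rintro ⟨m, rfl⟩
    cases m with
    | of x => exact absurd (hD _ he) (by simp [Multiset.count_singleton])
    | mul m n => exact ⟨leftExp_fst_ne_zero _, leftExp_mul_snd_ne_zero m n⟩
  · obtain ⟨s, t⟩ := e
    rintro ⟨hs, ht⟩
    obtain ⟨x, hx⟩ := Multiset.exists_mem_of_ne_zero hs
    obtain ⟨y, hy⟩ := Multiset.exists_mem_of_ne_zero ht
    obtain ⟨s, rfl⟩ := Multiset.exists_cons_of_mem hx
    obtain ⟨t, rfl⟩ := Multiset.exists_cons_of_mem hy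
    obtain ⟨m, n, h⟩ := exists_leftExp_mul_eq x y s t
    exact ⟨_, h⟩

theorem image_basisExponents {D : Set (Gen p q → ℕ)} (hD : ∀ d ∈ D, 1 < ∑ x, d x) :
    countEquiv p q '' basisExponents (exponentsOfDegree D) =
      reducedPairs D \ (Prod.mk 0 '' reducedDegrees D ∪ (fun g => (g, 0)) '' reducedDegrees D) := by
  ext f
  obtain ⟨e, rfl⟩ := (countEquiv p q).surjective f
  rw [(countEquiv p q).injective.mem_set_image, mem_basisExponents_iff hD, isReduced_iff]
  have h1 : e.1 = 0 ↔ (fun x => e.1.count x) = 0 := by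
    simp [funext_iff, Multiset.ext]
  have h2 : e.2 = 0 ↔ (fun x => e.2.count x) = 0 := by
    simp [funext_iff, Multiset.ext]
  have key : countEquiv p q e ∈ reducedPairs D ↔ e ∈ exponentsOfDegree D ∧
      (∀ j, e.1.count (.inr j) ≤ 1) ∧ ∀ j, e.2.count (.inr j) ≤ 1 := Iff.rfl
  rw [Set.mem_sdiff, key, ne_eq, ne_eq, h1, h2]
  constructor
  · rintro ⟨hd, hr, h1, h2⟩
    refine ⟨⟨hd, hr⟩, ?_⟩
    rintro (⟨g, -, hg⟩ | ⟨g, -, hg⟩)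
    · exact h1 (congrArg Prod.fst hg).symm
    · exact h2 (congrArg Prod.snd hg).symm
  · rintro ⟨⟨hd, hr⟩, h⟩
    have hd' : (fun x => e.1.count x) + (fun x => e.2.count x) ∈ D := hd
    refine ⟨hd, hr, fun h0 => h (.inl ⟨fun x => e.2.count x, ⟨?_, hr.2⟩, ?_⟩),
      fun h0 => h (.inr ⟨fun x => e.1.count x, ⟨?_, hr.1⟩, ?_⟩)⟩
    · rwa [h0, zero_add] at hd'
    · rw [countEquiv_apply, h0]
    · rwa [h0, add_zero] at hd'
    · rw [countEquiv_apply, h0]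

theorem finite_basisExponents {D : Set (Gen p q → ℕ)} (hfin : D.Finite)
    (hD : ∀ d ∈ D, 1 < ∑ x, d x) : (basisExponents (exponentsOfDegree D)).Finite := by
  refine Set.Finite.of_finite_image ?_ ((countEquiv p q).injective.injOn)
  rw [image_basisExponents hD]
  exact (finite_reducedPairs hfin).sdiff

theorem ncard_basisExponents {D : Set (Gen p q → ℕ)} (hfin : D.Finite)
    (hD : ∀ d ∈ D, 1 < ∑ x, d x) : ((basisExponents (exponentsOfDegree D)).ncard : ℤ) =
      (reducedPairs D).ncard - 2 * (reducedDegrees D).ncard := by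
  have hfin' : (reducedDegrees D).Finite := hfin.subset fun _ h => h.1
  have hsub : Prod.mk 0 '' reducedDegrees D ∪ (fun g => (g, 0)) '' reducedDegrees D ⊆
      reducedPairs D := by
    rintro _ (⟨g, hg, rfl⟩ | ⟨g, hg, rfl⟩)
    · exact ⟨by simpa using hg.1, by simp, hg.2⟩
    · exact ⟨by simpa using hg.1, hg.2, by simp⟩
  -- A common element would be (0, 0), of total degree 0.
  have hdisj : Disjoint (Prod.mk 0 '' reducedDegrees D)
      ((fun g => (g, (0 : Gen p q → ℕ))) '' reducedDegrees D) := by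
    rw [Set.disjoint_left]
    rintro _ ⟨g, hg, rfl⟩ ⟨g', hg', h⟩
    have h0 : g = 0 := (congrArg Prod.snd h).symm
    have := hD g hg.1
    simp [h0] at this
  have h1 := Set.ncard_sdiff_add_ncard_of_subset hsub (finite_reducedPairs hfin)
  rw [← image_basisExponents hD, Set.ncard_image_of_injective _ (countEquiv p q).injective,
    Set.ncard_union_eq hdisj (hfin'.image _) (hfin'.image _),
    Set.ncard_image_of_injective _ (Prod.mk_right_injective 0),
    Set.ncard_image_of_injective _ (Prod.mk_left_injective 0)] at h1
  omega

theorem hasDim_span_of_degree {K : Type*} [Field K] (hK : ringChar K ≠ 2)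
    {D : Set (Gen p q → ℕ)} (hfin : D.Finite) (hD : ∀ d ∈ D, 1 < ∑ x, d x) :
    HasDim K (Submodule.span K
        {f | ∃ m, (fun x => degree x m) ∈ D ∧ f = monomial K p q m})
      ((reducedPairs D).ncard - 2 * (reducedDegrees D).ncard) := by
  rw [← ncard_basisExponents hfin hD]
  simpa only [exponentsOfDegree, Set.mem_ofPred_eq, (count_leftExp_rightExp _ _).1] using
    hasDim_span_monomial (K := K) hK (finite_basisExponents hfin hD)

/-- A product has at least one letter on each side, so in degree one only the generators themselves
remain. -/
theorem hasDim_span_of_degree_one {K : Type*} [Field K] (hK : ringChar K ≠ 2)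
    {D : Set (Gen p q → ℕ)} (hD : ∀ d ∈ D, ∑ x, d x = 1) :
    HasDim K (Submodule.span K
        {f | ∃ m, (fun x => degree x m) ∈ D ∧ f = monomial K p q m})
      {x : Gen p q | (fun y => if x = y then 1 else 0) ∈ D}.ncard := by
  have himage : basisExponents (exponentsOfDegree D) =
      (fun x => ({x}, 0)) '' {x : Gen p q | (fun y => if x = y then 1 else 0) ∈ D} := by
    have hx : ∀ x : Gen p q, (({x}, 0) : Exponent p q) ∈ exponentsOfDegree D ↔
        (fun y => if x = y then 1 else 0) ∈ D := by
      intro x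
      simp [exponentsOfDegree, Multiset.count_singleton, eq_comm]
    ext e
    constructor
    · rintro ⟨he, -, m, rfl⟩
      cases m with
      | of x => exact ⟨x, (hx x).1 he, rfl⟩
      | mul m n =>
        exfalso
        have h := hD _ he
        rw [Finset.sum_add_distrib, Multiset.sum_count_eq_card (fun _ _ => Finset.mem_univ _),
          Multiset.sum_count_eq_card (fun _ _ => Finset.mem_univ _)] at h
        have h1 := Multiset.card_pos.2 (leftExp_fst_ne_zero (m * n))
        have h2 := Multiset.card_pos.2 (leftExp_mul_snd_ne_zero m n)
        simp only [FreeMagma.mul_eq] at h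
        omega
    · rintro ⟨x, h, rfl⟩
      refine ⟨(hx x).2 h, ?_, .of x, rfl⟩
      rw [isReduced_iff]
      refine ⟨fun j => ?_, by simp⟩
      rw [Multiset.count_singleton]
      split_ifs <;> simp
  have h := hasDim_span_monomial (K := K) hK (himage ▸ (Set.toFinite _).image _)
  rw [himage, Set.ncard_image_of_injective] at h
  · simpa only [exponentsOfDegree, Set.mem_ofPred_eq, (count_leftExp_rightExp _ _).1] using h
  · intro x y hxy
    simpa using hxy

/-- The splitting of the degree between the two sides is chosen independently for each generator, so
the count is a product over antidiagonals. -/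
theorem ncard_reducedPairs_singleton (d : Gen p q → ℕ) :
    ((reducedPairs {d}).ncard : ℤ) = (∏ i, ((d (.inl i) : ℤ) + 1)) *
      ∏ j, (kdelta 2 (d (.inr j)) + 2 * kdelta 1 (d (.inr j)) + kdelta 0 (d (.inr j))) := by
  let T : Gen p q → Finset (ℕ × ℕ) := Sum.elim (fun i => Finset.HasAntidiagonal.antidiagonal (d (.inl i)))
    fun j => (Finset.HasAntidiagonal.antidiagonal (d (.inr j))).filter fun x => x.1 ≤ 1 ∧ x.2 ≤ 1
  have : (Equiv.arrowProdEquivProdArrow (Gen p q) (fun _ => ℕ) (fun _ => ℕ)).symm ''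
      reducedPairs {d} = (Fintype.piFinset T : Set (Gen p q → ℕ × ℕ)) := by
    ext f
    simp only [Equiv.image_eq_preimage_symm, Equiv.symm_symm, Set.mem_preimage, reducedPairs,
      Set.mem_ofPred_eq, Set.mem_singleton_iff, funext_iff, Finset.mem_coe, Fintype.mem_piFinset,
      Sum.forall, T, Sum.elim_inl, Sum.elim_inr, Finset.mem_filter, Finset.HasAntidiagonal.mem_antidiagonal,
      Equiv.arrowProdEquivProdArrow_apply, Pi.add_apply, forall_and, and_assoc]
  rw [← Set.ncard_image_of_injective _ (Equiv.injective _), this, Set.ncard_coe_finset,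
    Fintype.card_piFinset, Fintype.prod_sum_type]
  push_cast
  simp only [T, Sum.elim_inl, Sum.elim_inr, card_filter_antidiagonal, Finset.Nat.card_antidiagonal]
  push_cast
  rfl

theorem ncard_reducedDegrees_singleton (d : Gen p q → ℕ) :
    ((reducedDegrees {d}).ncard : ℤ) =
      ∏ j, (kdelta 1 (d (.inr j)) + kdelta 0 (d (.inr j))) := by
  simp only [kdelta_one_add_kdelta_zero]
  by_cases h : ∀ j, d (.inr j) ≤ 1
  · have : reducedDegrees {d} = {d} := by
      ext f
      simp only [reducedDegrees, Set.mem_singleton_iff, Set.mem_ofPred_eq, and_iff_left_iff_imp]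
      rintro rfl
      exact h
    simp [this, h]
  · have : reducedDegrees {d} = ∅ := by
      ext f
      simp only [reducedDegrees, Set.mem_singleton_iff, Set.mem_ofPred_eq, Set.mem_empty_iff_false,
        iff_false, not_and]
      rintro rfl
      exact h
    rw [not_forall] at h
    obtain ⟨j, hj⟩ := h
    rw [this, Finset.prod_eq_zero (Finset.mem_univ j) (if_neg hj)]
    simp

/-- The multidegrees with total degree `k` in the even and `l` in the odd generators. -/
def bidegreeSet (p q k l : ℕ) : Set (Gen p q → ℕ) :=
  {d | ∑ i, d (.inl i) = k ∧ ∑ j, d (.inr j) = l}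

theorem finite_bidegreeSet (p q k l : ℕ) : (bidegreeSet p q k l).Finite := by
  refine (Set.finite_Icc (0 : Gen p q → ℕ) fun _ => k + l).subset ?_
  rintro d ⟨rfl, rfl⟩
  refine ⟨zero_le, ?_⟩
  rintro (i | j)
  · exact (Finset.single_le_sum (f := fun i => d (.inl i)) (by simp) (Finset.mem_univ i)).trans
      le_self_add
  · exact (Finset.single_le_sum (f := fun i => d (.inr i)) (by simp) (Finset.mem_univ j)).trans
      le_add_self

theorem ncard_reducedDegrees_bidegreeSet (p q k l : ℕ) :
    (reducedDegrees (bidegreeSet p q k l)).ncard = (p + k - 1).choose k * q.choose l := by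
  have := ncard_bidegree_eq (Fin p) (Fin q) k l
  rwa [Fintype.card_fin, Fintype.card_fin] at this

theorem ncard_reducedPairs_bidegreeSet (p q k l : ℕ) :
    (reducedPairs (bidegreeSet p q k l)).ncard =
      (p + p + k - 1).choose k * (q + q).choose l := by
  have := ncard_bidegree_eq (Fin p ⊕ Fin p) (Fin q ⊕ Fin q) k l
  rw [Fintype.card_sum, Fintype.card_sum, Fintype.card_fin, Fintype.card_fin] at this
  -- A pair of multidegrees is one multidegree in doubled variables, regrouped into 2p even and 2q
  -- odd ones.
  let E := (Equiv.sumArrowEquivProdArrow (Gen p q) (Gen p q) ℕ).symm.trans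
    ((Equiv.sumSumSumComm (Fin p) (Fin q) (Fin p) (Fin q)).arrowCongr (Equiv.refl ℕ))
  rw [← this, ← Set.ncard_image_of_injective _ E.injective]
  congr 1
  ext h
  obtain ⟨⟨f, g⟩, rfl⟩ := E.surjective h
  rw [E.injective.mem_set_image]
  simp [reducedPairs, bidegreeSet, Finset.sum_add_distrib, Fintype.sum_sum_type, Sum.forall, E]

end Exponents

end BicommSuper

end

/-! ### The dimension formulas -/

theorem corollary3p3 (K : Type*) [Field K] (hK : ringChar K ≠ 2) (p q : ℕ) :
    (∀ (k : Fin p → ℕ) (l : Fin q → ℕ), 1 < ∑ i, k i + ∑ j, l j →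
      BicommSuper.HasDim K (BicommSuper.multiComponent K k l)
        ((∏ i, ((k i : ℤ) + 1)) *
            (∏ j, (BicommSuper.kdelta 2 (l j) + 2 * BicommSuper.kdelta 1 (l j) +
              BicommSuper.kdelta 0 (l j))) -
          2 * ∏ j, (BicommSuper.kdelta 1 (l j) + BicommSuper.kdelta 0 (l j)))) ∧
    (∀ (k : Fin p → ℕ) (l : Fin q → ℕ), ∑ i, k i + ∑ j, l j = 1 →
      BicommSuper.HasDim K (BicommSuper.multiComponent K k l) 1) ∧
    (∀ k l : ℕ, 1 < k + l →
      BicommSuper.HasDim K (BicommSuper.biComponent K p q k l)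
        (((k + 2 * p - 1).choose k : ℤ) * ((2 * q).choose l : ℤ) -
          2 * ((k + p - 1).choose k : ℤ) * (q.choose l : ℤ))) ∧
    BicommSuper.HasDim K (BicommSuper.biComponent K p q 1 0) (p : ℤ) ∧
    BicommSuper.HasDim K (BicommSuper.biComponent K p q 0 1) (q : ℤ) := by
  have hmulti : ∀ (k : Fin p → ℕ) (l : Fin q → ℕ), BicommSuper.multiComponent K k l =
      Submodule.span K {f | ∃ m, (fun x => BicommSuper.degree x m) ∈
        ({Sum.elim k l} : Set (BicommSuper.Gen p q → ℕ)) ∧ f = BicommSuper.monomial K p q m} := by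
    intro k l
    simp [BicommSuper.multiComponent, funext_iff, Sum.forall, and_assoc]
  have hbi : ∀ k l : ℕ, BicommSuper.biComponent K p q k l =
      Submodule.span K {f | ∃ m, (fun x => BicommSuper.degree x m) ∈
        BicommSuper.bidegreeSet p q k l ∧ f = BicommSuper.monomial K p q m} := by
    intro k l
    simp [BicommSuper.biComponent, BicommSuper.bidegreeSet, BicommSuper.evenDegree,
      BicommSuper.oddDegree, and_assoc]
  have hsum : ∀ {k l : ℕ}, ∀ d ∈ BicommSuper.bidegreeSet p q k l, ∑ x, d x = k + l := by
    rintro k l d ⟨rfl, rfl⟩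
    exact Fintype.sum_sum_type d
  refine ⟨fun k l h => ?_, fun k l h => ?_, fun k l h => ?_, ?_, ?_⟩
  · have := BicommSuper.hasDim_span_of_degree hK (D := {Sum.elim k l}) (Set.finite_singleton _)
      (by simpa [Fintype.sum_sum_type] using h)
    rwa [BicommSuper.ncard_reducedPairs_singleton, BicommSuper.ncard_reducedDegrees_singleton,
      ← hmulti] at this
  · have h1 := BicommSuper.hasDim_span_of_degree_one hK (D := {Sum.elim k l})
      (by simpa [Fintype.sum_sum_type] using h)
    rw [← hmulti] at h1
    suffices {x : BicommSuper.Gen p q | (fun y => if x = y then 1 else 0) ∈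
        ({Sum.elim k l} : Set (BicommSuper.Gen p q → ℕ))}.ncard = 1 by rwa [this] at h1
    have hd : ∑ x, Sum.elim k l x = 1 := by rw [Fintype.sum_sum_type]; exact h
    obtain ⟨x, -, hx⟩ : ∃ x ∈ Finset.univ, Sum.elim k l x ≠ 0 :=
      Finset.exists_ne_zero_of_sum_ne_zero (by omega)
    -- A multidegree with sum 1 is the indicator of the one generator `x` where it is nonzero.
    rw [Set.ncard_eq_one]
    refine ⟨x, Set.eq_singleton_iff_unique_mem.2 ⟨?_, fun y hy => ?_⟩⟩
    · rw [Set.mem_ofPred_eq, Set.mem_singleton_iff]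
      rw [← Finset.add_sum_erase _ _ (Finset.mem_univ x)] at hd
      have h0 : ∑ y ∈ Finset.univ.erase x, Sum.elim k l y = 0 := by omega
      ext y
      split_ifs with hxy
      · subst hxy; omega
      · exact (Finset.sum_eq_zero_iff.1 h0 y
          (Finset.mem_erase.2 ⟨Ne.symm hxy, Finset.mem_univ y⟩)).symm
    · by_contra hne
      rw [Set.mem_ofPred_eq, Set.mem_singleton_iff] at hy
      exact hx (by rw [← hy]; exact if_neg hne)
  · have := BicommSuper.hasDim_span_of_degree hK (BicommSuper.finite_bidegreeSet p q k l)
      (fun d hd => by rwa [hsum d hd])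
    rw [BicommSuper.ncard_reducedPairs_bidegreeSet, BicommSuper.ncard_reducedDegrees_bidegreeSet,
      ← hbi] at this
    rw [two_mul p, two_mul q, add_comm k, add_comm k, mul_assoc]
    exact_mod_cast this
  · have h1 := BicommSuper.hasDim_span_of_degree_one hK (D := BicommSuper.bidegreeSet p q 1 0)
      (fun d hd => hsum d hd)
    rw [← hbi] at h1
    suffices {x : BicommSuper.Gen p q | (fun y => if x = y then 1 else 0) ∈
        BicommSuper.bidegreeSet p q 1 0} = Set.range Sum.inl by
      rwa [this, ← Set.image_univ, Set.ncard_image_of_injective _ Sum.inl_injective,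
        Set.ncard_univ, Nat.card_fin] at h1
    ext (i | j) <;> simp [BicommSuper.bidegreeSet, Finset.filter_eq]
  · have h1 := BicommSuper.hasDim_span_of_degree_one hK (D := BicommSuper.bidegreeSet p q 0 1)
      (fun d hd => hsum d hd)
    rw [← hbi] at h1
    suffices {x : BicommSuper.Gen p q | (fun y => if x = y then 1 else 0) ∈
        BicommSuper.bidegreeSet p q 0 1} = Set.range Sum.inr by
      rwa [this, ← Set.image_univ, Set.ncard_image_of_injective _ Sum.inr_injective,
        Set.ncard_univ, Nat.card_fin] at h1
    ext (i | j) <;> simp [BicommSuper.bidegreeSet, Finset.filter_eq]
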